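/- Let $\ell\ge 1$ and $n_1,\dots,n_\ell\ge 0$ be integers, and write $F_n$ for the free group of rank $n$. Let $$G=F_{n_\ell}\rtimes_{\alpha_\ell}(F_{n_{\ell-1}}\rtimes_{\alpha_{\ell-1}}(\cdots\rtimes_{\alpha_3}(F_{n_2}\rtimes_{\alpha_2}F_{n_1})))$$ be an almost-direct product of free groups, that is, an iterated semidirect product of finitely generated free groups in which, for each $2\le k\le \ell$, every automorphism in the image of $\alpha_k\colon F_{n_{k-1}}\rtimes\cdots\rtimes F_{n_1}\to\operatorname{Aut}(F_{n_k})$ induces the identity on the abelianization $H_1(F_{n_k};\mathbb Z)$ of $F_{n_k}$. Put $N=\sum_{k=1}^{\ell}n_k$. Then $G/[G,G]\cong\mathbb Z^N$. Moreover, for any choice of such an isomorphism, with $\mathfrak a\colon G\to G/[G,G]\cong\mathbb Z^N$ the resulting abelianization map, and for every $i\in\{0,1,2\}$, the induced map in integral homology $$\mathfrak a_*\colon H_i(G;\mathbb Z)\to H_i(\mathbb Z^N;\mathbb Z)$$ is injective, and the induced map in integral cohomology $$\mathfrak a^*\colon H^i(\mathbb Z^N;\mathbb Z)\to H^i(G;\mathbb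 Z)$$ is surjective (homology and cohomology with trivial coefficients). -/

import Mathlib

open CategoryTheory

/-- `f` is an IA-automorphism of `F`: it induces the identity on the abelianization
`F / [F, F] = H₁(F; ℤ)`. -/
def IsIAAut {F : Type*} [Group F] (f : MulAut F) : Prop :=
  Abelianization.map (f.toMonoidHom : F →* F) = MonoidHom.id (Abelianization F)

/-- `IsAlmostDirectProduct [n_ℓ, …, n_1] G` says that `G` is (isomorphic to) an almost-direct product
of free groups `F_{n_ℓ} ⋊ (F_{n_{ℓ-1}} ⋊ (⋯ ⋊ (F_{n_2} ⋊ F_{n_1})))`: an iterated semidirect product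
of finitely generated free groups in which every automorphism through which
`F_{n_{k-1}} ⋊ ⋯ ⋊ F_{n_1}` acts on `F_{n_k}` is an IA-automorphism, i.e. acts trivially on
`H₁(F_{n_k}; ℤ)`. -/
inductive IsAlmostDirectProduct : List ℕ → ∀ (G : Type) [Group G], Prop
  | free (n : ℕ) : IsAlmostDirectProduct [n] (FreeGroup (Fin n))
  | semidirect {ns : List ℕ} {H : Type} [Group H] (hH : IsAlmostDirectProduct ns H)
      (n : ℕ) (α : H →* MulAut (FreeGroup (Fin n))) (hα : ∀ h : H, IsIAAut (α h)) :
      IsAlmostDirectProduct (n :: ns) (FreeGroup (Fin n) ⋊[α] H)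
  | of_mulEquiv {ns : List ℕ} {G G' : Type} [Group G] [Group G']
      (hG : IsAlmostDirectProduct ns G) (e : G ≃* G') : IsAlmostDirectProduct ns G'

/-- The map `f_* : Hᵢ(G; ℤ) → Hᵢ(H; ℤ)` induced by a group homomorphism `f : G → H` (trivial
coefficients, identity on the coefficients). -/
noncomputable def integralHomologyMap {G H : Type} [Group G] [Group H] (f : G →* H) (i : ℕ) :
    groupHomology (Rep.trivial ℤ G ℤ) i →ₗ[ℤ] groupHomology (Rep.trivial ℤ H ℤ) i :=
  (groupHomology.map (A := Rep.trivial ℤ G ℤ) (B := Rep.trivial ℤ H ℤ) f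
    (Rep.ofHom ⟨LinearMap.id, fun _ => rfl⟩) i).hom

/-- The map `f^* : Hⁱ(H; ℤ) → Hⁱ(G; ℤ)` induced by a group homomorphism `f : G → H` (trivial
coefficients, identity on the coefficients). -/
noncomputable def integralCohomologyMap {G H : Type} [Group G] [Group H] (f : G →* H) (i : ℕ) :
    groupCohomology (Rep.trivial ℤ H ℤ) i →ₗ[ℤ] groupCohomology (Rep.trivial ℤ G ℤ) i :=
  (groupCohomology.map (A := Rep.trivial ℤ H ℤ) (B := Rep.trivial ℤ G ℤ) f
    (Rep.ofHom ⟨LinearMap.id, fun _ => rfl⟩) i).hom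

/-! Everything follows from one fact: for every abelian group `M` with trivial action, each
`M`-valued 2-cocycle on `G` is cohomologous to a bilinear one. A bilinear cocycle factors through
the abelianization in both variables, so it is pulled back from `ℤ^N`; this is surjectivity on `H²`.
Injectivity on `H₂` follows by taking `M` to be 2-chains modulo boundaries, with its tautological
cocycle.

The fact is proved by induction along `N ⋊ H` (`hasBilinearCocycles_semidirectProduct`). Modulo a
bilinear cocycle pulled back from `H`, the central extension splits over `H`, and it splits over the
free group `N`. What remains is the commutation defect between the two splittings, a pairing `H × N
→ M`, which the IA condition makes bilinear. -/

/-! ### Central extensions and bilinear representatives of 2-cocycles. -/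

section TwoCocycles

variable {G H M : Type} [Group G] [Group H] [CommGroup M]

/-- The 2-cocycle identity for functions with values in an abelian group with trivial action. -/
def IsTwoCocycle (f : G → G → M) : Prop :=
  ∀ a b c, f a b * f (a * b) c = f b c * f a (b * c)

theorem IsTwoCocycle.one_left {f : G → G → M} (hf : IsTwoCocycle f) (c : G) :
    f 1 c = f 1 1 := by
  have h := hf 1 1 c
  simp only [one_mul] at h
  exact (mul_right_cancel h).symm

theorem IsTwoCocycle.one_right {f : G → G → M} (hf : IsTwoCocycle f) (a : G) :
    f a 1 = f 1 1 := by
  have h := hf a 1 1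
  simp only [mul_one] at h
  exact mul_right_cancel h

theorem IsTwoCocycle.comp {f : G → G → M} (hf : IsTwoCocycle f) (j : H →* G) :
    IsTwoCocycle fun x y => f (j x) (j y) := fun a b c => by
  simpa using hf (j a) (j b) (j c)

theorem IsTwoCocycle.div {f f' : G → G → M} (hf : IsTwoCocycle f) (hf' : IsTwoCocycle f') :
    IsTwoCocycle fun x y => f x y / f' x y := fun a b c => by
  rw [div_mul_div_comm, div_mul_div_comm, hf a b c, hf' a b c]

theorem isTwoCocycle_of_bilinear (β : G →* G →* M) : IsTwoCocycle fun x y => β x y :=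
  fun a b c => by
    simp only [map_mul, MonoidHom.mul_apply, mul_left_comm, mul_comm]

/-- The central extension of `G` by `M` with factor set `f`. -/
@[ext]
structure CocycleExtension (f : G → G → M) (hf : IsTwoCocycle f) where
  fiber : M
  base : G

namespace CocycleExtension

variable {f : G → G → M} {hf : IsTwoCocycle f}

instance : Mul (CocycleExtension f hf) :=
  ⟨fun x y => ⟨x.fiber * y.fiber * f x.base y.base, x.base * y.base⟩⟩

/-- Cocycles are not assumed normalized, hence the correction by `f 1 1`. -/
instance : One (CocycleExtension f hf) := ⟨⟨(f 1 1)⁻¹, 1⟩⟩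

instance : Inv (CocycleExtension f hf) :=
  ⟨fun x => ⟨x.fiber⁻¹ * (f x.base⁻¹ x.base)⁻¹ * (f 1 1)⁻¹, x.base⁻¹⟩⟩

@[simp] theorem fiber_mul (x y : CocycleExtension f hf) :
    (x * y).fiber = x.fiber * y.fiber * f x.base y.base := rfl
@[simp] theorem base_mul (x y : CocycleExtension f hf) : (x * y).base = x.base * y.base := rfl
@[simp] theorem fiber_one : (1 : CocycleExtension f hf).fiber = (f 1 1)⁻¹ := rfl
@[simp] theorem base_one : (1 : CocycleExtension f hf).base = 1 := rfl
@[simp] theorem fiber_inv (x : CocycleExtension f hf) :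
    x⁻¹.fiber = x.fiber⁻¹ * (f x.base⁻¹ x.base)⁻¹ * (f 1 1)⁻¹ := rfl
@[simp] theorem base_inv (x : CocycleExtension f hf) : x⁻¹.base = x.base⁻¹ := rfl

instance : Group (CocycleExtension f hf) :=
  Group.ofLeftAxioms
    (fun x y z => by
      ext
      · have h := hf x.base y.base z.base
        simp only [fiber_mul, base_mul]
        calc x.fiber * y.fiber * f x.base y.base * z.fiber * f (x.base * y.base) z.base
            = x.fiber * y.fiber * z.fiber * (f x.base y.base * f (x.base * y.base) z.base) := by
              simp only [mul_left_comm, mul_comm]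
          _ = _ := by rw [h]; simp only [mul_left_comm, mul_comm]
      · simp [mul_assoc])
    (fun x => by
      ext
      · simp [hf.one_left x.base]
      · simp)
    (fun x => by
      ext
      · simp only [fiber_mul, fiber_inv, base_inv, fiber_one]
        rw [show x.fiber⁻¹ * (f x.base⁻¹ x.base)⁻¹ * (f 1 1)⁻¹ * x.fiber * f x.base⁻¹ x.base =
          (x.fiber⁻¹ * x.fiber) * ((f x.base⁻¹ x.base)⁻¹ * f x.base⁻¹ x.base) * (f 1 1)⁻¹ by
            simp only [mul_assoc, mul_left_comm, mul_comm]]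
        simp
      · simp)

variable (hf) in
/-- The projection of the central extension to `G`. -/
def baseHom : CocycleExtension f hf →* G where
  toFun := base
  map_one' := rfl
  map_mul' _ _ := rfl

variable (hf) in
/-- The inclusion of the central kernel. -/
def inclusion (m : M) : CocycleExtension f hf := ⟨m * (f 1 1)⁻¹, 1⟩

theorem inclusion_mul_eq (m : M) (x : CocycleExtension f hf) :
    inclusion hf m * x = ⟨m * x.fiber, x.base⟩ := by
  ext
  · simp [inclusion, hf.one_left x.base, mul_right_comm _ _ x.fiber]
  · simp [inclusion]

theorem mul_inclusion (m : M) (x : CocycleExtension f hf) :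
    x * inclusion hf m = inclusion hf m * x := by
  rw [inclusion_mul_eq]
  ext
  · simp [inclusion, hf.one_right x.base, mul_left_comm x.fiber, mul_assoc]
  · simp [inclusion]

theorem inclusion_mul (m n : M) : inclusion hf (m * n) = inclusion hf m * inclusion hf n := by
  rw [inclusion_mul_eq]
  simp [inclusion, mul_assoc]

theorem inclusion_injective : Function.Injective (inclusion hf) := fun m n h => by
  simpa [inclusion] using h

theorem eq_inclusion_mul {x y : CocycleExtension f hf} (h : x.base = y.base) :
    x = inclusion hf (x.fiber / y.fiber) * y := by
  rw [inclusion_mul_eq]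
  ext <;> simp [h]

/-- A trivialization of the pullback of the cocycle along `j` lifts `j` to the extension. -/
theorem exists_lift (hf : IsTwoCocycle f) (j : H →* G) (b : H → M)
    (h : ∀ x y, f (j x) (j y) = b x * b y * (b (x * y))⁻¹) :
    ∃ s : H →* CocycleExtension f hf, ∀ x, (s x).base = j x := by
  refine ⟨MonoidHom.mk' (fun x => ⟨(b x)⁻¹, j x⟩) fun x y => ?_, fun _ => rfl⟩
  ext
  · simp only [fiber_mul, h]
    rw [show (b x)⁻¹ * (b y)⁻¹ * (b x * b y * (b (x * y))⁻¹) =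
      ((b x)⁻¹ * b x) * ((b y)⁻¹ * b y) * (b (x * y))⁻¹ by
        simp only [mul_assoc, mul_left_comm, mul_comm]]
    simp
  · simp

end CocycleExtension

/-- Every 2-cocycle on `G` is cohomologous to a bilinear one, for every abelian group of
coefficients with trivial action. -/
def HasBilinearCocycles (G : Type) [Group G] : Prop :=
  ∀ (M : Type) [CommGroup M] (f : G → G → M), IsTwoCocycle f →
    ∃ (β : G →* G →* M) (b : G → M), ∀ x y, f x y = β x y * (b x * b y * (b (x * y))⁻¹)

theorem HasBilinearCocycles.of_mulEquiv (h : HasBilinearCocycles G) (e : G ≃* H) :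
    HasBilinearCocycles H := fun M _ f hf => by
  obtain ⟨β, b, hb⟩ := h M _ (hf.comp e.toMonoidHom)
  refine ⟨(MonoidHom.compHom' e.symm.toMonoidHom).comp (β.comp e.symm.toMonoidHom),
    b ∘ e.symm, fun x y => ?_⟩
  simpa using hb (e.symm x) (e.symm y)

/-- Lifting the generators arbitrarily splits the central extension; the inverse fiber coordinate of
the splitting is the trivializing cochain. -/
theorem IsTwoCocycle.exists_trivialization_freeGroup {α : Type} {f : FreeGroup α → FreeGroup α → M}
    (hf : IsTwoCocycle f) : ∃ b : FreeGroup α → M, ∀ x y, f x y = b x * b y * (b (x * y))⁻¹ := by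
  let s : FreeGroup α →* CocycleExtension f hf := FreeGroup.lift fun a => ⟨1, FreeGroup.of a⟩
  have hs : ∀ x, (s x).base = x := fun x => by
    have : (CocycleExtension.baseHom hf).comp s = MonoidHom.id _ := by
      ext a
      simp [s, CocycleExtension.baseHom]
    exact DFunLike.congr_fun this x
  refine ⟨fun x => ((s x).fiber)⁻¹, fun x y => ?_⟩
  have h : (s (x * y)).fiber = _ := congrArg CocycleExtension.fiber (map_mul s x y)
  rw [CocycleExtension.fiber_mul, hs, hs] at h
  simp only [inv_inv]
  rw [h, ← mul_inv, inv_mul_cancel_left]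

theorem hasBilinearCocycles_freeGroup (α : Type) : HasBilinearCocycles (FreeGroup α) :=
  fun M _ f hf => by
    obtain ⟨b, hb⟩ := hf.exists_trivialization_freeGroup
    exact ⟨1, b, fun x y => by simp [hb x y]⟩

theorem IsIAAut.apply_eq {F : Type*} [Group F] {σ : MulAut F} (hσ : IsIAAut σ) (φ : F →* M)
    (x : F) : φ (σ x) = φ x := by
  have h : Abelianization.of (σ x) = Abelianization.of x := by
    simpa using DFunLike.congr_fun hσ (Abelianization.of x)
  simpa using congrArg (Abelianization.lift φ) h

theorem hasBilinearCocycles_semidirectProduct {N : Type} [Group N] {α : H →* MulAut N}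
    (hα : ∀ h, IsIAAut (α h))
    (hN : ∀ (M : Type) [CommGroup M] (f : N → N → M), IsTwoCocycle f →
      ∃ b : N → M, ∀ x y, f x y = b x * b y * (b (x * y))⁻¹)
    (hH : HasBilinearCocycles H) : HasBilinearCocycles (N ⋊[α] H) := fun M _ f₀ hf₀ => by
  obtain ⟨βH, bH, hbH⟩ := hH M _ (hf₀.comp SemidirectProduct.inr)
  -- Dividing by this pullback of `βH` leaves a cocycle `f` whose restriction to `H` is a
  -- coboundary.
  let β₀ : N ⋊[α] H →* N ⋊[α] H →* M :=
    (MonoidHom.compHom' SemidirectProduct.rightHom).comp (βH.comp SemidirectProduct.rightHom)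
  obtain ⟨f, hf_def⟩ : ∃ f : N ⋊[α] H → N ⋊[α] H → M, f = fun x y => f₀ x y / β₀ x y := ⟨_, rfl⟩
  have hf : IsTwoCocycle f := hf_def ▸ hf₀.div (isTwoCocycle_of_bilinear β₀)
  obtain ⟨bN, hbN⟩ := hN M _ (hf.comp SemidirectProduct.inl)
  obtain ⟨sN, hsN⟩ := CocycleExtension.exists_lift hf SemidirectProduct.inl bN hbN
  obtain ⟨sH, hsH⟩ := CocycleExtension.exists_lift hf SemidirectProduct.inr bH fun x y => by
    simp [hf_def, hbH, β₀]
  let ι := CocycleExtension.inclusion hf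
  have ι_comm : ∀ m x, x * ι m = ι m * x := CocycleExtension.mul_inclusion
  have ι_mul : ∀ m n, ι (m * n) = ι m * ι n := CocycleExtension.inclusion_mul
  -- Both products lie over `h x = (α h x) h`, so they differ by a central element.
  have exists_pairing : ∀ h x, ∃ m, sH h * sN x = ι m * (sN (α h x) * sH h) := fun h x =>
    ⟨_, CocycleExtension.eq_inclusion_mul (by simp [hsN, hsH, SemidirectProduct.inl_aut])⟩
  choose φ hφ using exists_pairing
  have φ_mul : ∀ h x y, φ h (x * y) = φ h x * φ h y := fun h x y => by
    apply CocycleExtension.inclusion_injective (hf := hf)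
    apply mul_right_cancel (b := sN (α h (x * y)) * sH h)
    change ι _ * _ = ι _ * _
    rw [← hφ, map_mul, map_mul, map_mul, ← mul_assoc, hφ, mul_assoc, mul_assoc, hφ,
      ← mul_assoc (sN _) (ι _), ι_comm, ι_mul]
    simp only [mul_assoc]
  let Φ (h : H) : N →* M := MonoidHom.mk' (φ h) (φ_mul h)
  -- Moving `h * k` past `x` in two stages yields `φ k x * φ h (α k x)`. Since `φ h` is a
  -- homomorphism to an abelian group, it does not see the IA-automorphism `α k`.
  have mul_φ : ∀ h k x, φ (h * k) x = φ h x * φ k x := fun h k x => by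
    have hk : φ h (α k x) = φ h x := (hα k).apply_eq (Φ h) x
    rw [mul_comm (φ h x), ← hk]
    apply CocycleExtension.inclusion_injective (hf := hf)
    apply mul_right_cancel (b := sN (α (h * k) x) * sH (h * k))
    change ι _ * _ = ι _ * _
    rw [← hφ, map_mul, map_mul, mul_assoc, hφ, ← mul_assoc, ι_comm, mul_assoc, ← mul_assoc (sH h),
      hφ, ι_mul]
    simp only [mul_assoc, MulAut.mul_apply]
  let Ψ : H →* N →* M := MonoidHom.mk' Φ fun h k => MonoidHom.ext (mul_φ h k)
  -- The left coordinate is multiplicative only up to the action, which homomorphisms to `M` ignore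
  -- by the IA condition.
  let β₁ : N ⋊[α] H →* N ⋊[α] H →* M := MonoidHom.mk'
    (fun g => MonoidHom.mk' (fun g' => Ψ g.right g'.left) fun x y => by
      rw [SemidirectProduct.mul_left, map_mul, (hα x.right).apply_eq])
    fun g g' => by ext; simp
  let s (g : N ⋊[α] H) : CocycleExtension f hf := sN g.left * sH g.right
  have hs : ∀ g, (s g).base = g := fun g => by simp [s, hsN, hsH]
  refine ⟨β₀ * β₁, fun g => ((s g).fiber)⁻¹, fun g g' => ?_⟩
  -- The set-theoretic section `s` has factor set `β₁`, so `f` and `β₁` are cohomologous.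
  have key : s g * s g' = ι (β₁ g g') * s (g * g') := by
    change sN g.left * sH g.right * (sN g'.left * sH g'.right) =
      ι (φ g.right g'.left) * (sN (g.left * α g.right g'.left) * sH (g.right * g'.right))
    rw [map_mul, map_mul, mul_assoc, ← mul_assoc (sH _), hφ, mul_assoc, ← mul_assoc (sN _) (ι _),
      ι_comm]
    simp only [mul_assoc]
  have h := congrArg CocycleExtension.fiber key
  rw [CocycleExtension.inclusion_mul_eq, CocycleExtension.fiber_mul, hs, hs] at h
  have hf₀' : f₀ g g' = β₀ g g' * f g g' := by simp [hf_def]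
  rw [hf₀', MonoidHom.mul_apply, MonoidHom.mul_apply, mul_assoc, inv_inv, eq_inv_mul_of_mul_eq h]
  rw [mul_inv]
  simp only [mul_assoc, mul_left_comm, mul_comm]

theorem IsAlmostDirectProduct.hasBilinearCocycles {ns : List ℕ}
    (hG : IsAlmostDirectProduct ns G) : HasBilinearCocycles G := by
  induction hG with
  | free n => exact hasBilinearCocycles_freeGroup _
  | semidirect _ n α hα ih =>
    exact hasBilinearCocycles_semidirectProduct hα
      (fun _ _ _ hf => hf.exists_trivialization_freeGroup) ih
  | of_mulEquiv _ e ih => exact ih.of_mulEquiv e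

end TwoCocycles

/-! ### The abelianization of an almost-direct product. -/

section AbelianizationEquiv

/-- The abelianization of a free group of finite rank. -/
noncomputable def abelianizationFreeGroupEquiv (n : ℕ) :
    Abelianization (FreeGroup (Fin n)) ≃* Multiplicative (Fin n → ℤ) :=
  AddEquiv.toMultiplicativeRight
    ((FreeAbelianGroup.equivFinsupp (Fin n)).trans
      (Finsupp.linearEquivFunOnFinite ℤ ℤ (Fin n)).toAddEquiv)

/-- The abelianization of a semidirect product `N ⋊ H` in which `H` acts trivially on the
abelianization of `N`. -/
def abelianizationSemidirectProductEquiv {N H : Type*} [Group N] [Group H] {α : H →* MulAut N}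
    (hα : ∀ h, IsIAAut (α h)) :
    Abelianization (N ⋊[α] H) ≃* Abelianization N × Abelianization H :=
  MonoidHom.toMulEquiv
    (Abelianization.lift (MonoidHom.mk' (fun g => (Abelianization.of g.left,
      Abelianization.of g.right)) fun x y => by
        ext
        · simpa using DFunLike.congr_fun (hα x.right) (Abelianization.of y.left)
        · simp))
    ((Abelianization.map SemidirectProduct.inl).coprod (Abelianization.map SemidirectProduct.inr))
    (by
      ext g
      simp [← map_mul])
    (by
      refine MonoidHom.ext fun ⟨x, y⟩ => ?_
      obtain ⟨x, rfl⟩ : ∃ a, Abelianization.of a = x := QuotientGroup.mk_surjective x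
      obtain ⟨y, rfl⟩ : ∃ a, Abelianization.of a = y := QuotientGroup.mk_surjective y
      simp)

/-- Concatenation of integer vectors. -/
def multiplicativeFinAppendEquiv (m n : ℕ) :
    Multiplicative (Fin m → ℤ) × Multiplicative (Fin n → ℤ) ≃* Multiplicative (Fin (m + n) → ℤ) :=
  (MulEquiv.prodMultiplicative _ _).symm.trans <| AddEquiv.toMultiplicative
    { toEquiv := Fin.appendEquiv m n
      map_add' := fun x y => by
        ext i
        refine Fin.addCases (fun i => ?_) (fun i => ?_) i <;> simp [Fin.appendEquiv] }

theorem IsAlmostDirectProduct.nonempty_abelianization_mulEquiv {ns : List ℕ} {G : Type} [Group G]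
    (hG : IsAlmostDirectProduct ns G) :
    Nonempty (Abelianization G ≃* Multiplicative (Fin ns.sum → ℤ)) := by
  induction hG with
  | free n => exact ⟨abelianizationFreeGroupEquiv n⟩
  | semidirect _ n α hα ih =>
    obtain ⟨e⟩ := ih
    exact ⟨(abelianizationSemidirectProductEquiv hα).trans
      (((abelianizationFreeGroupEquiv n).prodCongr e).trans (multiplicativeFinAppendEquiv _ _))⟩
  | of_mulEquiv _ e ih => exact ih.map e.abelianizationCongr.symm.trans

end AbelianizationEquiv

/-! ### From homomorphisms and 2-cocycles to (co)homology in degrees at most 2. -/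

section LowDegree

open Finsupp

variable {G A : Type} [Group G] [Group A]

theorem exists_linearMap_single {X M : Type*} [AddCommGroup M] (φ : X → M) :
    ∃ L : (X →₀ ℤ) →ₗ[ℤ] M, ∀ x n, L (single x n) = n • φ x :=
  ⟨lsum ℤ fun x => LinearMap.toSpanSingleton ℤ M (φ x), by simp⟩

theorem integralHomologyMap_zero_injective (f : G →* A) :
    Function.Injective (integralHomologyMap f 0) := by
  rw [injective_iff_map_eq_zero]
  intro x hx
  induction x using groupHomology.H0_induction_on with | h x =>
  have h := ConcreteCategory.congr_hom (groupHomology.H0π_comp_map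
    (A := Rep.trivial ℤ G ℤ) (B := Rep.trivial ℤ A ℤ) f
    (Rep.ofHom ⟨LinearMap.id, fun _ => rfl⟩)) x
  have h₀ : groupHomology.H0π (Rep.trivial ℤ A ℤ) x = 0 := h.symm.trans hx
  have h₁ : x = 0 :=
    (groupHomology.H0IsoOfIsTrivial (Rep.trivial ℤ A ℤ)).symm.toLinearEquiv.injective
      (h₀.trans (map_zero _).symm)
  rw [h₁]
  exact map_zero _

/-- The tautological map `G → C₁/B₁` is a homomorphism; its factorization through `f` gives a
functional on chains of `A` that kills boundaries and detects whether a cycle of `G` bounds. -/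
theorem integralHomologyMap_one_injective (f : G →* A)
    (hf : ∀ (M : Type) [CommGroup M] (φ : G →* M), ∃ ψ : A →* M, φ = ψ.comp f) :
    Function.Injective (integralHomologyMap f 1) := by
  rw [injective_iff_map_eq_zero]
  intro x hx
  induction x using groupHomology.H1_induction_on with | h z =>
  have h := ConcreteCategory.congr_hom (groupHomology.H1π_comp_map
    (A := Rep.trivial ℤ G ℤ) (B := Rep.trivial ℤ A ℤ) f
    (Rep.ofHom ⟨LinearMap.id, fun _ => rfl⟩)) z
  replace h := h.symm.trans hx
  obtain ⟨w, hw⟩ := (groupHomology.H1π_eq_zero_iff _).1 h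
  refine (groupHomology.H1π_eq_zero_iff _).2 ?_
  let B := groupHomology.boundaries₁ (Rep.trivial ℤ G ℤ)
  let M := (G →₀ ℤ) ⧸ B
  have single_mul : ∀ x y : G, (B.mkQ (single (x * y) (1 : ℤ)) : M) =
      B.mkQ (single x (1 : ℤ)) + B.mkQ (single y (1 : ℤ)) := fun x y => by
    rw [← map_add, eq_comm]
    refine (Submodule.Quotient.eq B).2 ⟨single (x, y) (1 : ℤ), ?_⟩
    refine (groupHomology.d₂₁_single (A := Rep.trivial ℤ G ℤ) (x, y) (1 : ℤ)).trans ?_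
    simp
    abel
  obtain ⟨ψ, hψ⟩ := hf (Multiplicative M)
    (MonoidHom.mk' (fun x => Multiplicative.ofAdd (B.mkQ (single x (1 : ℤ)))) single_mul)
  obtain ⟨L, hLs⟩ := exists_linearMap_single fun a => (ψ a).toAdd
  have hL : L ∘ₗ (groupHomology.d₂₁ (Rep.trivial ℤ A ℤ)).hom = 0 := by
    refine lhom_ext fun a (n : ℤ) => ?_
    refine (congrArg L (groupHomology.d₂₁_single (A := Rep.trivial ℤ A ℤ) a n)).trans ?_
    change L (single a.2 n - single (a.1 * a.2) n + single a.1 n) = 0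
    rw [map_add, map_sub, hLs, hLs, hLs, map_mul, toAdd_mul, smul_add]
    abel
  have hL' : L ∘ₗ (groupHomology.chainsMap₁ (A := Rep.trivial ℤ G ℤ) (B := Rep.trivial ℤ A ℤ) f
    (Rep.ofHom ⟨LinearMap.id, fun _ => rfl⟩)).hom = B.mkQ := by
    refine lhom_ext fun x (n : ℤ) => ?_
    have hx : (ψ (f x)).toAdd = B.mkQ (single x (1 : ℤ)) :=
      (congrArg Multiplicative.toAdd (DFunLike.congr_fun hψ x)).symm
    have hn : (single x n : G →₀ ℤ) = n • single x 1 := by simp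
    refine Eq.trans ?_ ((congrArg (n • ·) hx).trans
      ((map_smul B.mkQ n (single x 1)).symm.trans (congrArg B.mkQ hn.symm)))
    simp [hLs]
  rw [← Submodule.Quotient.mk_eq_zero]
  refine (LinearMap.congr_fun hL' z.1).symm.trans ?_
  refine (congrArg L hw.symm).trans ?_
  exact LinearMap.congr_fun hL w

/-- Same device with the tautological 2-cocycle `G × G → C₂/B₂`. The coboundary of `b` contributes a
term factoring through `d₂₁`, which vanishes on cycles. -/
theorem integralHomologyMap_two_injective (f : G →* A)
    (hf : ∀ (M : Type) [CommGroup M] (c : G → G → M), IsTwoCocycle c →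
      ∃ (c' : A → A → M) (b : G → M), IsTwoCocycle c' ∧
        ∀ x y, c x y = c' (f x) (f y) * (b x * b y * (b (x * y))⁻¹)) :
    Function.Injective (integralHomologyMap f 2) := by
  rw [injective_iff_map_eq_zero]
  intro x hx
  induction x using groupHomology.H2_induction_on with | h z =>
  have h := ConcreteCategory.congr_hom (groupHomology.H2π_comp_map
    (A := Rep.trivial ℤ G ℤ) (B := Rep.trivial ℤ A ℤ) f
    (Rep.ofHom ⟨LinearMap.id, fun _ => rfl⟩)) z
  replace h := h.symm.trans hx
  obtain ⟨w, hw⟩ := (groupHomology.H2π_eq_zero_iff _).1 h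
  refine (groupHomology.H2π_eq_zero_iff _).2 ?_
  let B := groupHomology.boundaries₂ (Rep.trivial ℤ G ℤ)
  let M := (G × G →₀ ℤ) ⧸ B
  have cocycle : IsTwoCocycle fun x y : G =>
      Multiplicative.ofAdd (B.mkQ (single (x, y) (1 : ℤ)) : M) := fun x y z => by
    change (B.mkQ (single (x, y) (1 : ℤ)) + B.mkQ (single (x * y, z) (1 : ℤ)) : M) =
      B.mkQ (single (y, z) (1 : ℤ)) + B.mkQ (single (x, y * z) (1 : ℤ))
    rw [← map_add, ← map_add, eq_comm]
    refine (Submodule.Quotient.eq B).2 ⟨single (x, y, z) (1 : ℤ), ?_⟩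
    refine (groupHomology.d₃₂_single (A := Rep.trivial ℤ G ℤ) (x, y, z) (1 : ℤ)).trans ?_
    simp
    abel
  obtain ⟨c, b, hc, hcb⟩ := hf (Multiplicative M) _ cocycle
  obtain ⟨L, hLs⟩ := exists_linearMap_single fun a : A × A => (c a.1 a.2).toAdd
  obtain ⟨L₁, hL₁s⟩ := exists_linearMap_single fun x => (b x).toAdd
  have hL : L ∘ₗ (groupHomology.d₃₂ (Rep.trivial ℤ A ℤ)).hom = 0 := by
    refine lhom_ext fun a (n : ℤ) => ?_
    refine (congrArg L (groupHomology.d₃₂_single (A := Rep.trivial ℤ A ℤ) a n)).trans ?_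
    have ha := congrArg (n • Multiplicative.toAdd ·) (hc a.1 a.2.1 a.2.2)
    simp only [toAdd_mul, smul_add] at ha
    change L (single (a.2.1, a.2.2) n - single (a.1 * a.2.1, a.2.2) n +
      single (a.1, a.2.1 * a.2.2) n - single (a.1, a.2.1) n) = 0
    rw [map_sub, map_add, map_sub, hLs, hLs, hLs, hLs, sub_add_eq_add_sub, ← ha]
    abel
  have hL' : L ∘ₗ (groupHomology.chainsMap₂ (A := Rep.trivial ℤ G ℤ) (B := Rep.trivial ℤ A ℤ) f
    (Rep.ofHom ⟨LinearMap.id, fun _ => rfl⟩)).hom +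
      L₁ ∘ₗ (groupHomology.d₂₁ (Rep.trivial ℤ G ℤ)).hom = B.mkQ := by
    refine lhom_ext fun x (n : ℤ) => ?_
    have hx : B.mkQ (single x (1 : ℤ)) = (c (f x.1) (f x.2)).toAdd +
        ((b x.1).toAdd + (b x.2).toAdd - (b (x.1 * x.2)).toAdd) :=
      (congrArg Multiplicative.toAdd (hcb x.1 x.2)).trans (by simp [sub_eq_add_neg])
    have hd : L₁ ((groupHomology.d₂₁ (Rep.trivial ℤ G ℤ)).hom (single x n)) =
        n • ((b x.1).toAdd + (b x.2).toAdd - (b (x.1 * x.2)).toAdd) := by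
      refine (congrArg L₁ (groupHomology.d₂₁_single (A := Rep.trivial ℤ G ℤ) x n)).trans ?_
      change L₁ (single x.2 n - single (x.1 * x.2) n + single x.1 n) = _
      rw [map_add, map_sub, hL₁s, hL₁s, hL₁s, smul_sub, smul_add]
      abel
    have hn : (single x n : G × G →₀ ℤ) = n • single x 1 := by simp
    refine (congrArg₂ (· + ·) ?_ hd).trans
      ((smul_add n _ _).symm.trans ((congrArg (n • ·) hx.symm).trans
        ((map_smul B.mkQ n (single x 1)).symm.trans (congrArg B.mkQ hn.symm))))
    simp [hLs]
  have hz : (groupHomology.d₂₁ (Rep.trivial ℤ G ℤ)).hom z.1 = 0 := z.2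
  rw [← Submodule.Quotient.mk_eq_zero]
  refine (LinearMap.congr_fun hL' z.1).symm.trans ?_
  refine (congrArg₂ (· + ·) ((congrArg L hw.symm).trans (LinearMap.congr_fun hL w))
    ((congrArg L₁ hz).trans (map_zero L₁))).trans (add_zero _)

theorem integralCohomologyMap_zero_surjective (f : G →* A) :
    Function.Surjective (integralCohomologyMap f 0) := by
  intro x
  let e := (groupCohomology.H0IsoOfIsTrivial (Rep.trivial ℤ G ℤ)).toLinearEquiv
  let e' := (groupCohomology.H0IsoOfIsTrivial (Rep.trivial ℤ A ℤ)).toLinearEquiv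
  refine ⟨e'.symm (e x : ℤ), e.injective ?_⟩
  refine (ConcreteCategory.congr_hom (groupCohomology.map_H0Iso_hom_f
    (A := Rep.trivial ℤ A ℤ) (B := Rep.trivial ℤ G ℤ) f
    (Rep.ofHom ⟨LinearMap.id, fun _ => rfl⟩)) _).trans ?_
  exact e'.apply_symm_apply _

theorem integralCohomologyMap_one_surjective (f : G →* A)
    (hf : ∀ (M : Type) [CommGroup M] (φ : G →* M), ∃ ψ : A →* M, φ = ψ.comp f) :
    Function.Surjective (integralCohomologyMap f 1) := by
  intro x
  induction x using groupCohomology.H1_induction_on with | h z =>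
  obtain ⟨ψ, hψ⟩ := hf (Multiplicative ℤ) (MonoidHom.mk' (fun x => Multiplicative.ofAdd (z x : ℤ))
    (groupCohomology.cocycles₁_map_mul_of_isTrivial z))
  refine ⟨groupCohomology.H1π _ ⟨fun a => (ψ a).toAdd,
    (groupCohomology.mem_cocycles₁_iff _).2 fun a a' => ?_⟩, ?_⟩
  · simp [add_comm]
  · refine (ConcreteCategory.congr_hom (groupCohomology.H1π_comp_map
      (A := Rep.trivial ℤ A ℤ) (B := Rep.trivial ℤ G ℤ) f
      (Rep.ofHom ⟨LinearMap.id, fun _ => rfl⟩)) _).trans ?_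
    refine congrArg (groupCohomology.H1π (Rep.trivial ℤ G ℤ)) (Subtype.ext (funext fun x => ?_))
    exact (congrArg Multiplicative.toAdd (DFunLike.congr_fun hψ x)).symm

theorem integralCohomologyMap_two_surjective (f : G →* A)
    (hf : ∀ (M : Type) [CommGroup M] (c : G → G → M), IsTwoCocycle c →
      ∃ (c' : A → A → M) (b : G → M), IsTwoCocycle c' ∧
        ∀ x y, c x y = c' (f x) (f y) * (b x * b y * (b (x * y))⁻¹)) :
    Function.Surjective (integralCohomologyMap f 2) := by
  intro x
  induction x using groupCohomology.H2_induction_on with | h z =>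
  obtain ⟨c, b, hc, hcb⟩ := hf (Multiplicative ℤ)
    (fun x y => Multiplicative.ofAdd (z (x, y) : ℤ)) fun x y t => by
      have := (groupCohomology.mem_cocycles₂_iff _).1 z.2 x y t
      exact (add_comm _ _).trans this
  refine ⟨groupCohomology.H2π _ ⟨fun a => (c a.1 a.2).toAdd,
    (groupCohomology.mem_cocycles₂_iff _).2 fun a a' a'' => ?_⟩, ?_⟩
  · exact (add_comm _ _).trans (congrArg Multiplicative.toAdd (hc a a' a''))
  · refine (ConcreteCategory.congr_hom (groupCohomology.H2π_comp_map
      (A := Rep.trivial ℤ A ℤ) (B := Rep.trivial ℤ G ℤ) f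
      (Rep.ofHom ⟨LinearMap.id, fun _ => rfl⟩)) _).trans ?_
    -- The sign is negative because the coboundary must equal the pulled-back cocycle minus `z`.
    refine (groupCohomology.H2π_eq_iff _ _).2 ⟨fun x => -(b x).toAdd, funext fun x => ?_⟩
    have hx : z x = (c (f x.1) (f x.2)).toAdd +
        ((b x.1).toAdd + (b x.2).toAdd - (b (x.1 * x.2)).toAdd) :=
      (congrArg Multiplicative.toAdd (hcb x.1 x.2)).trans (by simp [sub_eq_add_neg])
    change -(b x.2).toAdd - -(b (x.1 * x.2)).toAdd + -(b x.1).toAdd =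
      (c (f x.1) (f x.2)).toAdd - z x
    rw [hx]
    ring

end LowDegree

theorem theorem2p1 (ns : List ℕ) (G : Type) [Group G] (hG : IsAlmostDirectProduct ns G) :
    Nonempty (Abelianization G ≃* Multiplicative (Fin ns.sum → ℤ)) ∧
    ∀ e : Abelianization G ≃* Multiplicative (Fin ns.sum → ℤ), ∀ i : ℕ, i ≤ 2 →
      Function.Injective
        (integralHomologyMap (e.toMonoidHom.comp Abelianization.of) i) ∧
      Function.Surjective
        (integralCohomologyMap (e.toMonoidHom.comp Abelianization.of) i) := by
  refine ⟨hG.nonempty_abelianization_mulEquiv, fun e => ?_⟩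
  set f := e.toMonoidHom.comp Abelianization.of with f_def
  have factors : ∀ (M : Type) [CommGroup M] (φ : G →* M),
      ∃ ψ : Multiplicative (Fin ns.sum → ℤ) →* M, φ = ψ.comp f := fun M _ φ =>
    ⟨(Abelianization.lift φ).comp e.symm.toMonoidHom, by ext; simp [f_def]⟩
  have cocycles : ∀ (M : Type) [CommGroup M] (c : G → G → M), IsTwoCocycle c →
      ∃ (c' : Multiplicative (Fin ns.sum → ℤ) → Multiplicative (Fin ns.sum → ℤ) → M) (b : G → M),
        IsTwoCocycle c' ∧ ∀ x y, c x y = c' (f x) (f y) * (b x * b y * (b (x * y))⁻¹) :=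
    fun M _ c hc => by
      obtain ⟨β, b, hβ⟩ := hG.hasBilinearCocycles M c hc
      -- As `G →* M` is abelian, `β` factors through `f` in its first variable; flipping handles the
      -- second.
      obtain ⟨γ, hγ⟩ := factors _ β
      obtain ⟨δ, hδ⟩ := factors _ γ.flip
      refine ⟨fun a a' => δ.flip a a', b, isTwoCocycle_of_bilinear δ.flip, fun x y => ?_⟩
      rw [hβ, hγ]
      exact congrArg (· * _) (DFunLike.congr_fun (DFunLike.congr_fun hδ y) (f x))
  intro i hi
  interval_cases i
  · exact ⟨integralHomologyMap_zero_injective f, integralCohomologyMap_zero_surjective f⟩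
  · exact ⟨integralHomologyMap_one_injective f factors,
      integralCohomologyMap_one_surjective f factors⟩
  · exact ⟨integralHomologyMap_two_injective f cocycles,
      integralCohomologyMap_two_surjective f cocycles⟩
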